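/- Let $\nu\in(0,1]$, $L>0$ and $\bar\varepsilon>0$. Then there are constants $c_1,c_2>0$ and a smoothing parameter $\mu=\mu(n,\varepsilon)\in(0,1)$, defined for integers $n\ge 1$ and $0<\varepsilon\le\bar\varepsilon$ and depending only on $n,\varepsilon,\nu,L,\bar\varepsilon$, such that $$c_1\,\frac{\varepsilon^{\frac{3+\nu}{4\nu}}}{n^{\frac{3+7\nu}{4\nu}}}\;\le\;\frac{\mu^{\frac{3+\nu}{2}}}{n^{\frac{3-\nu}{4}}}\;\le\; c_2\,\frac{\varepsilon^{\frac{3+\nu}{4\nu}}}{n^{\frac{3+7\nu}{4\nu}}},$$ and for every $\Delta\in\mathbb{R}$ there is a constant $C>0$ (depending only on $\nu,L,\bar\varepsilon,\Delta$ and the choice of $\mu(\cdot,\cdot)$) such that for all $n\ge1$ and $0<\varepsilon\le\bar\varepsilon$ there is a number of steps $$N\;\le\; C\,\frac{n^{2+\frac{1-\nu}{2\nu}}}{\varepsilon^{\frac1\nu}}$$ for which the following holds. Let $E$ be an $n$-dimensional real vector space with dual $E^*$, with the Euclidean norms $\|x\|^2=\langle Bx,x\rangle$ on $E$ and $\|s\|_*^2=\langle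 s,B^{-1}s\rangle$ on $E^*$, where $B:E\to E^*$ is linear, self-adjoint and positive definite. Let $f:E\to\mathbb{R}$ be differentiable and bounded below with $\|\nabla f(y)-\nabla f(x)\|_*\le L\|y-x\|^\nu$ for all $x,y\in E$. Let $x_0\in E$ satisfy $f(x_0)-\inf f\le\Delta$, and let $\tilde f:E\to\mathbb{R}$ be a measurable inexact zeroth-order oracle, $|f(x)-\tilde f(x)|\le\delta$ for all $x\in E$, with noise level $$\delta<\frac{\mu^{\frac{3+\nu}{2}}}{n^{\frac{3-\nu}{4}}}.$$ Let $u_0,u_1,\dots$ be independent standard Gaussian vectors in $E$ (density proportional to $e^{-\|u\|^2/2}$), and let $$x_{k+1}=x_k-h\,B^{-1}g_\mu(x_k,u_k),\qquad g_\mu(x,u)=\frac{\tilde f(x+\mu u)-\tilde f(x)}{\mu}\,Bu,\qquad h=\frac{\mu^{1-\nu}}{80\,(n+4)\,L\,n^{\frac{1+\nu}{2}}}.$$ Then $\mathbb{E}\|\nabla f(x_k)\|_*^2<\infty$ for all $0\le k<N$, and $$\min_{0\le k\le N-1}\mathbb{E}\,\|\nabla f(x_k)\|_*^2\le\varepsilon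 .$$ -/

import Mathlib

open MeasureTheory ProbabilityTheory

noncomputable section

namespace ZerothOrder

/-! The space `E` with `‖x‖² = ⟨B x, x⟩` for a positive definite self-adjoint `B : E → E*` is a
finite-dimensional real inner product space.  Its dual is `StrongDual ℝ E`, whose operator norm is
the norm `‖s‖_*² = ⟨s, B⁻¹ s⟩`, and `B` is the Riesz isomorphism `InnerProductSpace.toDual ℝ E`.
The gradient of `f` at `x`, as an element of the dual, is `fderiv ℝ f x`.  The Gaussian vector with
density proportional to `exp (-‖u‖² / 2)` has law `stdGaussian E`. -/

variable {E : Type*} [NormedAddCommGroup E] [InnerProductSpace ℝ E]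

/-- `f` is differentiable and its gradient is Hölder-continuous with exponent `ν` and
constant `L`. -/
def HasHolderGradient (f : E → ℝ) (ν L : ℝ) : Prop :=
  Differentiable ℝ f ∧ ∀ x y : E, ‖fderiv ℝ f y - fderiv ℝ f x‖ ≤ L * ‖y - x‖ ^ ν

/-- `ftil` is a zeroth-order oracle for `f` with error at most `δ`. -/
def IsInexactOracle (f ftil : E → ℝ) (δ : ℝ) : Prop :=
  ∀ x : E, |f x - ftil x| ≤ δ

variable [FiniteDimensional ℝ E]

/-- The finite-difference estimator `g_μ(x, u) = (ftil (x + μ u) - ftil x) / μ • B u`. -/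
def gradEstimator (ftil : E → ℝ) (μ : ℝ) (x u : E) : StrongDual ℝ E :=
  ((ftil (x + μ • u) - ftil x) / μ) • InnerProductSpace.toDual ℝ E u

/-- The process `x_{k+1} = x_k - h B⁻¹ g_μ(x_k, u_k)` started at `x₀`, with step size `h`, along
the sequence of directions `u`. -/
def gdProcess (ftil : E → ℝ) (μ h : ℝ) (x₀ : E) (u : ℕ → E) : ℕ → E
  | 0 => x₀
  | k + 1 =>
    gdProcess ftil μ h x₀ u k -
      h • (InnerProductSpace.toDual ℝ E).symm
        (gradEstimator ftil μ (gdProcess ftil μ h x₀ u k) (u k))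

/-- The step size `h = 1 / (80 (n + 4) A)` with `A = L n ^ ((1 + ν) / 2) / μ ^ (1 - ν)`. -/
def stepSize (ν L μ : ℝ) (n : ℕ) : ℝ :=
  1 / (80 * ((n : ℝ) + 4) * (L * (n : ℝ) ^ ((1 + ν) / 2) / μ ^ (1 - ν)))

/-- The noise level `μ ^ ((3 + ν) / 2) / n ^ ((3 - ν) / 4)`. -/
def noiseLevel (ν μ : ℝ) (n : ℕ) : ℝ :=
  μ ^ ((3 + ν) / 2) / (n : ℝ) ^ ((3 - ν) / 4)

/-- The order `ε ^ ((3 + ν) / (4 ν)) / n ^ ((3 + 7 ν) / (4 ν))` of the noise level. -/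
def noiseOrder (ν ε : ℝ) (n : ℕ) : ℝ :=
  ε ^ ((3 + ν) / (4 * ν)) / (n : ℝ) ^ ((3 + 7 * ν) / (4 * ν))

/-- The order `n ^ (2 + (1 - ν) / (2 ν)) / ε ^ (1 / ν)` of the number of steps. -/
def stepsOrder (ν ε : ℝ) (n : ℕ) : ℝ :=
  (n : ℝ) ^ (2 + (1 - ν) / (2 * ν)) / ε ^ (1 / ν)

end ZerothOrder

end

/-! Young's inequality at the scale `μ / √n` turns the Hölder condition into a quadratic upper model
of `f` with constant `A = L n ^ ((1 + ν) / 2) / μ ^ (1 - ν)` and a small additive error, so the step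
size `1 / (80 (n + 4) A)` is the one of the smooth case. The difference quotient of the oracle
differs from the directional derivative `⟨∇f x, u⟩` by a smoothing error and a noise error, both
with controlled Gaussian moments. Averaging over the Gaussian direction, one step from `x` decreases
`f` by at least `h / 2 * ‖∇f x‖²` minus `h` times an error `D`. Since `u k` is independent of the
`k`-th iterate, these inequalities telescope, and the average over `k < N` of the expected squared
gradient norms is at most `2 (f x₀ - inf f) / (h N) + 2 D`. With `μ ^ (2 ν)` proportional to
`ε / n ^ (1 + ν)` the error `D` is at most `ε / 4`, and `N ≥ 4 Δ / (h ε)` steps suffice. -/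

open Module (finrank)

open scoped ENNReal

namespace ZerothOrder

section Gaussian

lemma integral_pow_two_mul_gaussianReal (k : ℕ) :
    ∫ x, x ^ (2 * k) ∂(gaussianReal 0 1) = ((2 * k - 1 : ℕ).doubleFactorial : ℝ) := by
  let F : ℝ → ℝ := fun y =>
    (√(2 * Real.pi))⁻¹ * (y ^ ((2 * k : ℕ) : ℝ) * Real.exp (-(1 / 2) * y ^ (2 : ℝ)))
  have hF : ∀ x : ℝ, gaussianPDFReal 0 1 x • x ^ (2 * k) = F |x| := by
    intro x
    simp only [F, gaussianPDFReal, smul_eq_mul, Real.rpow_natCast, Real.rpow_two, sq_abs,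
      NNReal.coe_one, mul_one, sub_zero]
    rw [(even_two_mul k).pow_abs]
    ring_nf
  have hk : (((2 * k : ℕ) : ℝ) + 1) / 2 = k + 1 / 2 := by
    push_cast
    ring
  have half_rpow : (1 / 2 : ℝ) ^ (-(k + 1 / 2 : ℝ)) = 2 ^ k * √2 := by
    rw [one_div (2 : ℝ), Real.inv_rpow zero_le_two, Real.rpow_neg zero_le_two, inv_inv,
      Real.rpow_add two_pos, Real.rpow_natCast, ← one_div (2 : ℝ), ← Real.sqrt_eq_rpow]
  calc ∫ x, x ^ (2 * k) ∂(gaussianReal 0 1)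
      = ∫ x, F |x| := by
        rw [integral_gaussianReal_eq_integral_smul one_ne_zero, integral_congr_ae (ae_of_all _ hF)]
    _ = 2 * ((√(2 * Real.pi))⁻¹ *
          ((1 / 2 : ℝ) ^ (-(k + 1 / 2 : ℝ)) * (1 / 2) * Real.Gamma (k + 1 / 2))) := by
        rw [integral_comp_abs (f := F), integral_const_mul,
          integral_rpow_mul_exp_neg_mul_rpow two_pos
            (by linarith [(2 * k : ℕ).cast_nonneg (α := ℝ)]) (by norm_num), neg_div, hk]
    _ = ((2 * k - 1 : ℕ).doubleFactorial : ℝ) := by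
        rw [Real.Gamma_nat_add_half, half_rpow, Real.sqrt_mul zero_le_two]
        field_simp

lemma norm_pow_two_mul_le_card_pow_mul_sum {E ι : Type*} [NormedAddCommGroup E]
    [InnerProductSpace ℝ E] [Fintype ι] (b : OrthonormalBasis ι ℝ E) (u : E) (k : ℕ) :
    ‖u‖ ^ (2 * (k + 1)) ≤
      (Fintype.card ι : ℝ) ^ k * ∑ i, innerSL ℝ (b i) u ^ (2 * (k + 1)) := by
  have hu : ‖u‖ ^ 2 = ∑ i, innerSL ℝ (b i) u ^ 2 := by
    simp [← b.sum_sq_norm_inner_right u]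
  simpa only [pow_mul, hu, Finset.card_univ] using
    pow_sum_le_card_mul_sum_pow (s := Finset.univ) (f := fun i => innerSL ℝ (b i) u ^ 2)
      (fun i _ => sq_nonneg _) k

variable {E : Type*} [NormedAddCommGroup E] [InnerProductSpace ℝ E] [FiniteDimensional ℝ E]
  [MeasurableSpace E] [BorelSpace E]

lemma integrable_norm_pow_stdGaussian (k : ℕ) :
    Integrable (fun u : E => ‖u‖ ^ k) (stdGaussian E) :=
  (IsGaussian.memLp_id (stdGaussian E) k (by simp)).integrable_norm_pow'

lemma integrable_dual_pow_mul_norm_pow_stdGaussian (φ : StrongDual ℝ E) (j k : ℕ) :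
    Integrable (fun u : E => φ u ^ j * ‖u‖ ^ k) (stdGaussian E) := by
  refine ((integrable_norm_pow_stdGaussian (j + k)).const_mul (‖φ‖ ^ j)).mono'
    (by fun_prop) (ae_of_all _ fun u => ?_)
  rw [norm_mul, norm_pow, norm_pow, norm_norm, pow_add, ← mul_assoc, ← mul_pow]
  gcongr
  exact φ.le_opNorm u

lemma integrable_dual_pow_stdGaussian (φ : StrongDual ℝ E) (k : ℕ) :
    Integrable (fun u : E => φ u ^ k) (stdGaussian E) := by
  simpa only [pow_zero, mul_one] using integrable_dual_pow_mul_norm_pow_stdGaussian φ k 0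

lemma map_dual_stdGaussian (φ : StrongDual ℝ E) :
    (stdGaussian E).map φ = (gaussianReal 0 1).map (‖φ‖ * ·) := by
  rw [IsGaussian.map_eq_gaussianReal, integral_strongDual_stdGaussian, variance_dual_stdGaussian,
    gaussianReal_map_const_mul, mul_zero, mul_one, Real.toNNReal_of_nonneg (sq_nonneg _)]

lemma integral_dual_pow_two_mul_stdGaussian (φ : StrongDual ℝ E) (k : ℕ) :
    ∫ u, φ u ^ (2 * k) ∂(stdGaussian E) =
      ‖φ‖ ^ (2 * k) * ((2 * k - 1 : ℕ).doubleFactorial : ℝ) := by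
  calc ∫ u, φ u ^ (2 * k) ∂(stdGaussian E)
      = ∫ x, x ^ (2 * k) ∂((stdGaussian E).map φ) := by
        rw [integral_map (by fun_prop) (by fun_prop)]
    _ = ∫ x, (‖φ‖ * x) ^ (2 * k) ∂(gaussianReal 0 1) := by
        rw [map_dual_stdGaussian, integral_map (by fun_prop) (by fun_prop)]
    _ = ‖φ‖ ^ (2 * k) * ((2 * k - 1 : ℕ).doubleFactorial : ℝ) := by
        simp_rw [mul_pow]
        rw [integral_const_mul, integral_pow_two_mul_gaussianReal]

lemma integral_dual_sq_stdGaussian (φ : StrongDual ℝ E) :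
    ∫ u, φ u ^ 2 ∂(stdGaussian E) = ‖φ‖ ^ 2 := by
  simpa [Nat.doubleFactorial] using integral_dual_pow_two_mul_stdGaussian φ 1

lemma integral_dual_pow_four_stdGaussian (φ : StrongDual ℝ E) :
    ∫ u, φ u ^ 4 ∂(stdGaussian E) = 3 * ‖φ‖ ^ 4 := by
  simpa [Nat.doubleFactorial, mul_comm] using integral_dual_pow_two_mul_stdGaussian φ 2

lemma integral_norm_pow_two_mul_stdGaussian_le (k : ℕ) :
    ∫ u : E, ‖u‖ ^ (2 * k) ∂(stdGaussian E) ≤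
      ((2 * k - 1 : ℕ).doubleFactorial : ℝ) * (finrank ℝ E : ℝ) ^ k := by
  rcases k with _ | k
  · simp
  let b := stdOrthonormalBasis ℝ E
  have hint : ∀ i, Integrable (fun u => innerSL ℝ (b i) u ^ (2 * (k + 1))) (stdGaussian E) :=
    fun i => integrable_dual_pow_stdGaussian _ _
  calc ∫ u : E, ‖u‖ ^ (2 * (k + 1)) ∂(stdGaussian E)
      ≤ ∫ u : E, (finrank ℝ E : ℝ) ^ k * ∑ i, innerSL ℝ (b i) u ^ (2 * (k + 1))
          ∂(stdGaussian E) :=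
        integral_mono (integrable_norm_pow_stdGaussian _)
          ((integrable_finsetSum _ fun i _ => hint i).const_mul _)
          fun u => by simpa using norm_pow_two_mul_le_card_pow_mul_sum b u k
    _ = (finrank ℝ E : ℝ) ^ k *
          ∑ _i : Fin (finrank ℝ E), ((2 * (k + 1) - 1 : ℕ).doubleFactorial : ℝ) := by
        rw [integral_const_mul, integral_finsetSum _ fun i _ => hint i]
        simp_rw [integral_dual_pow_two_mul_stdGaussian, innerSL_apply_norm, b.norm_eq_one,
          one_pow, one_mul]
    _ = ((2 * (k + 1) - 1 : ℕ).doubleFactorial : ℝ) * (finrank ℝ E : ℝ) ^ (k + 1) := by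
        rw [Finset.sum_const, Finset.card_univ, Fintype.card_fin, nsmul_eq_mul]
        ring

lemma integral_norm_sq_stdGaussian_le : ∫ u : E, ‖u‖ ^ 2 ∂(stdGaussian E) ≤ finrank ℝ E := by
  simpa [Nat.doubleFactorial] using integral_norm_pow_two_mul_stdGaussian_le (E := E) 1

lemma integral_norm_pow_four_stdGaussian_le :
    ∫ u : E, ‖u‖ ^ 4 ∂(stdGaussian E) ≤ 3 * (finrank ℝ E : ℝ) ^ 2 := by
  simpa [Nat.doubleFactorial] using integral_norm_pow_two_mul_stdGaussian_le (E := E) 2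

lemma integral_norm_pow_six_stdGaussian_le :
    ∫ u : E, ‖u‖ ^ 6 ∂(stdGaussian E) ≤ 15 * (finrank ℝ E : ℝ) ^ 3 := by
  simpa [Nat.doubleFactorial] using integral_norm_pow_two_mul_stdGaussian_le (E := E) 3

lemma integral_dual_sq_mul_norm_sq_stdGaussian_le (φ : StrongDual ℝ E) :
    ∫ u : E, φ u ^ 2 * ‖u‖ ^ 2 ∂(stdGaussian E) ≤ 3 * finrank ℝ E * ‖φ‖ ^ 2 := by
  rcases eq_or_ne φ 0 with rfl | hφ
  · simp
  have : Nontrivial E := by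
    by_contra! h
    exact hφ (Subsingleton.elim φ 0)
  set c : ℝ := finrank ℝ E * ‖φ‖ ^ 2 with hc
  have hc₀ : 0 < c := mul_pos (mod_cast Module.finrank_pos) (pow_pos (norm_pos_iff.2 hφ) 2)
  have i₄ := (integrable_dual_pow_stdGaussian φ 4).const_mul ((finrank ℝ E : ℝ) ^ 2)
  have j₄ := (integrable_norm_pow_stdGaussian (E := E) 4).const_mul (‖φ‖ ^ 4)
  have amgm : ∫ u : E, 2 * c * (φ u ^ 2 * ‖u‖ ^ 2) ∂(stdGaussian E) ≤
      ∫ u : E, ((finrank ℝ E : ℝ) ^ 2 * φ u ^ 4 + ‖φ‖ ^ 4 * ‖u‖ ^ 4) ∂(stdGaussian E) :=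
    integral_mono ((integrable_dual_pow_mul_norm_pow_stdGaussian _ _ _).const_mul _) (i₄.add j₄)
      fun u => by
        simp only [hc]
        linarith [sq_nonneg (finrank ℝ E * φ u ^ 2 - ‖φ‖ ^ 2 * ‖u‖ ^ 2)]
  rw [integral_const_mul, integral_add i₄ j₄, integral_const_mul, integral_const_mul,
    integral_dual_pow_four_stdGaussian] at amgm
  refine le_of_mul_le_mul_left (amgm.trans ?_) (mul_pos two_pos hc₀)
  calc (finrank ℝ E : ℝ) ^ 2 * (3 * ‖φ‖ ^ 4) + ‖φ‖ ^ 4 * ∫ u : E, ‖u‖ ^ 4 ∂(stdGaussian E)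
      ≤ (finrank ℝ E : ℝ) ^ 2 * (3 * ‖φ‖ ^ 4) + ‖φ‖ ^ 4 * (3 * (finrank ℝ E : ℝ) ^ 2) := by
        gcongr
        exact integral_norm_pow_four_stdGaussian_le
    _ = 2 * c * (3 * finrank ℝ E * ‖φ‖ ^ 2) := by
        rw [hc]
        ring

end Gaussian

section Holder

lemma norm_sub_sub_fderiv_le_of_holder {E F : Type*} [NormedAddCommGroup E] [NormedSpace ℝ E]
    [NormedAddCommGroup F] [NormedSpace ℝ F] {f : E → F} {ν L : ℝ} (hν : 0 ≤ ν)
    (hf : Differentiable ℝ f)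
    (hf' : ∀ x y, ‖fderiv ℝ f y - fderiv ℝ f x‖ ≤ L * ‖y - x‖ ^ ν) (x y : E) :
    ‖f y - f x - fderiv ℝ f x (y - x)‖ ≤ L * ‖y - x‖ ^ (1 + ν) := by
  rcases eq_or_ne y x with rfl | hxy
  · simp [Real.zero_rpow (by linarith : 1 + ν ≠ 0)]
  have hpos : 0 < ‖y - x‖ := norm_pos_iff.2 (sub_ne_zero.2 hxy)
  have hL : 0 ≤ L :=
    nonneg_of_mul_nonneg_left ((norm_nonneg _).trans (hf' x y)) (Real.rpow_pos_of_pos hpos ν)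
  have hbound : ∀ z ∈ segment ℝ x y, ‖fderiv ℝ f z - fderiv ℝ f x‖ ≤ L * ‖y - x‖ ^ ν := by
    intro z hz
    refine (hf' x z).trans ?_
    gcongr
    exact norm_sub_le_of_mem_segment hz
  calc ‖f y - f x - fderiv ℝ f x (y - x)‖ ≤ L * ‖y - x‖ ^ ν * ‖y - x‖ :=
        (convex_segment x y).norm_image_sub_le_of_norm_fderiv_le' (fun z _ => hf z) hbound
          (left_mem_segment ℝ x y) (right_mem_segment ℝ x y)
    _ = L * ‖y - x‖ ^ (1 + ν) := by rw [mul_assoc, ← Real.rpow_add_one hpos.ne', add_comm ν]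

lemma rpow_le_rpow_mul_one_add_div_rpow {t s p q : ℝ} (ht : 0 ≤ t) (hs : 0 < s) (hp : 0 ≤ p)
    (hpq : p ≤ q) : t ^ p ≤ s ^ p * (1 + (t / s) ^ q) := by
  have hts : 0 ≤ t / s := div_nonneg ht hs.le
  calc t ^ p = s ^ p * (t / s) ^ p := by
        rw [← Real.mul_rpow hs.le hts, mul_div_cancel₀ t hs.ne']
    _ ≤ s ^ p * (1 + (t / s) ^ q) := by
        gcongr
        rcases le_total (t / s) 1 with h | h
        · exact (Real.rpow_le_one hts h hp).trans (le_add_of_nonneg_right (by positivity))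
        · exact (Real.rpow_le_rpow_of_exponent_le h hpq).trans
            (le_add_of_nonneg_left zero_le_one)

end Holder

section StepSize

variable {ν L μ : ℝ} {n : ℕ}

/-- The constant `A = L n ^ ((1 + ν) / 2) / μ ^ (1 - ν)` of the quadratic model that replaces the
Hölder condition; the step size is `1 / (80 (n + 4) A)`. -/
noncomputable def curvature (ν L μ : ℝ) (n : ℕ) : ℝ :=
  L * (n : ℝ) ^ ((1 + ν) / 2) / μ ^ (1 - ν)

/-- The contribution `L² μ ^ (2 ν) n ^ (1 + ν)` of the smoothing to the squared gradient norm that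
the method can reach. -/
noncomputable def smoothingError (ν L μ : ℝ) (n : ℕ) : ℝ :=
  L ^ 2 * μ ^ (2 * ν) * (n : ℝ) ^ (1 + ν)

lemma smoothingError_nonneg (hμ : 0 ≤ μ) : 0 ≤ smoothingError ν L μ n := by
  unfold smoothingError
  positivity

lemma curvature_pos (hL : 0 < L) (hμ : 0 < μ) (hn : 0 < n) : 0 < curvature ν L μ n := by
  unfold curvature
  positivity

lemma stepSize_pos (hL : 0 < L) (hμ : 0 < μ) (hn : 0 < n) : 0 < stepSize ν L μ n := by
  unfold stepSize
  positivity

lemma stepSize_mul_curvature (hL : 0 < L) (hμ : 0 < μ) (hn : 0 < n) :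
    stepSize ν L μ n * curvature ν L μ n = 1 / (80 * (n + 4)) := by
  have hA : 0 < curvature ν L μ n := curvature_pos hL hμ hn
  rw [stepSize, ← curvature]
  field_simp

lemma mul_div_sqrt_rpow_div_sq_le_curvature (hν : 0 ≤ ν) (hL : 0 ≤ L) (hμ : 0 < μ) (hn : 0 < n) :
    L * (μ / √n) ^ (1 + ν) / (μ / √n) ^ 2 ≤ curvature ν L μ n := by
  have hn₀ : (0 : ℝ) < n := Nat.cast_pos.2 hn
  have hs : 0 < μ / √n := by positivity
  calc L * (μ / √n) ^ (1 + ν) / (μ / √n) ^ 2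
      = L * (μ / √n) ^ (-(1 - ν)) := by
        rw [mul_div_assoc, ← Real.rpow_two, ← Real.rpow_sub hs]
        ring_nf
    _ = L * (n : ℝ) ^ ((1 - ν) / 2) / μ ^ (1 - ν) := by
        rw [Real.rpow_neg hs.le, Real.div_rpow hμ.le (Real.sqrt_nonneg _), inv_div,
          Real.sqrt_eq_rpow, ← Real.rpow_mul hn₀.le, mul_div_assoc]
        ring_nf
    _ ≤ curvature ν L μ n := by
        unfold curvature
        gcongr
        · exact Nat.one_le_cast.2 hn
        · linarith

lemma mul_rpow_one_add_le_curvature_mul_sq {t : ℝ} (hν₀ : 0 ≤ ν) (hν₁ : ν ≤ 1) (hL : 0 ≤ L)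
    (hμ : 0 < μ) (hn : 0 < n) (ht : 0 ≤ t) :
    L * t ^ (1 + ν) ≤ curvature ν L μ n * t ^ 2 + L * (μ / √n) ^ (1 + ν) := by
  have hs : 0 < μ / √n := by positivity
  calc L * t ^ (1 + ν) ≤ L * ((μ / √n) ^ (1 + ν) * (1 + (t / (μ / √n)) ^ (2 : ℝ))) := by
        gcongr
        exact rpow_le_rpow_mul_one_add_div_rpow ht hs (by linarith) (by linarith)
    _ = L * (μ / √n) ^ (1 + ν) / (μ / √n) ^ 2 * t ^ 2 + L * (μ / √n) ^ (1 + ν) := by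
        rw [Real.rpow_two, div_pow]
        ring
    _ ≤ curvature ν L μ n * t ^ 2 + L * (μ / √n) ^ (1 + ν) := by
        gcongr
        exact mul_div_sqrt_rpow_div_sq_le_curvature hν₀ hL hμ hn

lemma curvature_mul_div_sqrt_rpow (hμ : 0 < μ) (hn : 0 < n) :
    curvature ν L μ n * (L * (μ / √n) ^ (1 + ν)) = L ^ 2 * μ ^ (2 * ν) := by
  have hn₀ : (0 : ℝ) < n := Nat.cast_pos.2 hn
  have hpow : (μ / √n) ^ (1 + ν) = μ ^ (2 * ν) * μ ^ (1 - ν) / (n : ℝ) ^ ((1 + ν) / 2) := by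
    rw [Real.div_rpow hμ.le (Real.sqrt_nonneg _), Real.sqrt_eq_rpow, ← Real.rpow_mul hn₀.le,
      ← Real.rpow_add hμ]
    ring_nf
  rw [curvature, hpow]
  field_simp

lemma mul_div_sqrt_rpow_le_smoothingError (hν : 0 ≤ ν) (hL : 0 < L) (hμ : 0 < μ) (hn : 0 < n) :
    L * (μ / √n) ^ (1 + ν) ≤ stepSize ν L μ n * (400 * smoothingError ν L μ n) := by
  have hn₁ : (1 : ℝ) ≤ n := Nat.one_le_cast.2 hn
  have hh : 0 < stepSize ν L μ n := stepSize_pos hL hμ hn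
  have hdim : (n : ℝ) + 4 ≤ 5 * (n : ℝ) ^ (1 + ν) := by
    linarith [Real.self_le_rpow_of_one_le hn₁ (by linarith : 1 ≤ 1 + ν)]
  calc L * (μ / √n) ^ (1 + ν)
      = stepSize ν L μ n * curvature ν L μ n * (80 * (n + 4)) * (L * (μ / √n) ^ (1 + ν)) := by
        rw [stepSize_mul_curvature hL hμ hn]
        field_simp
    _ = stepSize ν L μ n * (80 * (n + 4)) *
          (curvature ν L μ n * (L * (μ / √n) ^ (1 + ν))) := by ring
    _ = stepSize ν L μ n * (80 * (n + 4)) * (L ^ 2 * μ ^ (2 * ν)) := by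
        rw [curvature_mul_div_sqrt_rpow hμ hn]
    _ ≤ stepSize ν L μ n * (80 * (5 * (n : ℝ) ^ (1 + ν))) * (L ^ 2 * μ ^ (2 * ν)) := by gcongr
    _ = stepSize ν L μ n * (400 * smoothingError ν L μ n) := by
        rw [smoothingError]
        ring

end StepSize

section GrowthWeight

variable {E : Type*} [NormedAddCommGroup E] {ν : ℝ} {n : ℕ}

/-- The weight `1 + (‖u‖² / n)²`, which bounds `(‖u‖² / n) ^ p` for all exponents `0 ≤ p ≤ 2` and
has bounded Gaussian mean. -/
noncomputable def growthWeight (n : ℕ) (u : E) : ℝ :=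
  1 + (‖u‖ ^ 2 / n) ^ 2

lemma one_le_growthWeight (n : ℕ) (u : E) : 1 ≤ growthWeight n u :=
  le_add_of_nonneg_right (sq_nonneg _)

lemma norm_rpow_one_add_sq_le (hν₀ : 0 ≤ ν) (hν₁ : ν ≤ 1) (hn : 0 < n) (u : E) :
    (‖u‖ ^ (1 + ν)) ^ 2 ≤ (n : ℝ) ^ (1 + ν) * growthWeight n u := by
  calc (‖u‖ ^ (1 + ν)) ^ 2 = (‖u‖ ^ 2) ^ (1 + ν) := by
        rw [← Real.rpow_natCast, ← Real.rpow_natCast, ← Real.rpow_mul (norm_nonneg u),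
          ← Real.rpow_mul (norm_nonneg u), mul_comm]
    _ ≤ (n : ℝ) ^ (1 + ν) * (1 + (‖u‖ ^ 2 / n) ^ (2 : ℝ)) :=
        rpow_le_rpow_mul_one_add_div_rpow (by positivity) (by positivity) (by linarith)
          (by linarith)
    _ = (n : ℝ) ^ (1 + ν) * growthWeight n u := by rw [Real.rpow_two, growthWeight]

end GrowthWeight

section Estimator

variable {E : Type*} [NormedAddCommGroup E] [InnerProductSpace ℝ E]
  {f ftil : E → ℝ} {ν L μ δ : ℝ} {n : ℕ}

/-- The forward difference quotient of `g` at `x` along `u`, the scalar factor of the gradient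
estimator. -/
noncomputable def differenceQuotient (g : E → ℝ) (μ : ℝ) (x u : E) : ℝ :=
  (g (x + μ • u) - g x) / μ

/-- The factor of `growthWeight n u` in the squared error of the difference quotient along `u` of an
oracle of accuracy `δ`. -/
noncomputable def estimatorError (ν L μ δ : ℝ) (n : ℕ) : ℝ :=
  2 * smoothingError ν L μ n + 8 * (δ / μ) ^ 2

lemma estimatorError_nonneg (hμ : 0 ≤ μ) : 0 ≤ estimatorError ν L μ δ n := by
  have : 0 ≤ smoothingError ν L μ n := smoothingError_nonneg hμ
  unfold estimatorError
  positivity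

lemma abs_differenceQuotient_sub_fderiv_le (hν : 0 ≤ ν) (hμ : 0 < μ)
    (hf : HasHolderGradient f ν L) (x u : E) :
    |differenceQuotient f μ x u - fderiv ℝ f x u| ≤ L * μ ^ ν * ‖u‖ ^ (1 + ν) := by
  have hquot : differenceQuotient f μ x u - fderiv ℝ f x u =
      (f (x + μ • u) - f x - μ * fderiv ℝ f x u) / μ := by
    rw [differenceQuotient]
    field_simp
  have htaylor := norm_sub_sub_fderiv_le_of_holder hν hf.1 hf.2 x (x + μ • u)
  rw [add_sub_cancel_left, map_smul, smul_eq_mul, norm_smul, Real.norm_of_nonneg hμ.le,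
    Real.mul_rpow hμ.le (norm_nonneg u), Real.rpow_add hμ, Real.rpow_one,
    Real.norm_eq_abs] at htaylor
  rw [hquot, abs_div, abs_of_pos hμ, div_le_iff₀ hμ]
  linarith

lemma abs_differenceQuotient_sub_differenceQuotient_le (hμ : 0 < μ)
    (ho : IsInexactOracle f ftil δ) (x u : E) :
    |differenceQuotient ftil μ x u - differenceQuotient f μ x u| ≤ 2 * (δ / μ) := by
  have hquot : differenceQuotient ftil μ x u - differenceQuotient f μ x u =
      ((f x - ftil x) - (f (x + μ • u) - ftil (x + μ • u))) / μ := by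
    rw [differenceQuotient, differenceQuotient]
    ring
  rw [hquot, abs_div, abs_of_pos hμ, mul_div_assoc', two_mul]
  gcongr
  exact (abs_sub _ _).trans (add_le_add (ho _) (ho _))

lemma sq_differenceQuotient_sub_fderiv_le (hν₀ : 0 ≤ ν) (hν₁ : ν ≤ 1) (hμ : 0 < μ) (hn : 0 < n)
    (hf : HasHolderGradient f ν L) (ho : IsInexactOracle f ftil δ) (x u : E) :
    (differenceQuotient ftil μ x u - fderiv ℝ f x u) ^ 2 ≤
      estimatorError ν L μ δ n * growthWeight n u := by
  have habs : |differenceQuotient ftil μ x u - fderiv ℝ f x u| ≤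
      2 * (δ / μ) + L * μ ^ ν * ‖u‖ ^ (1 + ν) :=
    (abs_sub_le _ (differenceQuotient f μ x u) _).trans (add_le_add
      (abs_differenceQuotient_sub_differenceQuotient_le hμ ho x u)
      (abs_differenceQuotient_sub_fderiv_le hν₀ hμ hf x u))
  have hμν : (μ ^ ν) ^ 2 = μ ^ (2 * ν) := by
    rw [← Real.rpow_mul_natCast hμ.le, mul_comm ν, Nat.cast_ofNat]
  calc (differenceQuotient ftil μ x u - fderiv ℝ f x u) ^ 2
      ≤ (2 * (δ / μ) + L * μ ^ ν * ‖u‖ ^ (1 + ν)) ^ 2 := by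
        rw [← sq_abs]
        gcongr
    _ ≤ 2 * ((2 * (δ / μ)) ^ 2 + (L * μ ^ ν * ‖u‖ ^ (1 + ν)) ^ 2) := add_sq_le
    _ = 8 * (δ / μ) ^ 2 * 1 + 2 * (L ^ 2 * μ ^ (2 * ν)) * (‖u‖ ^ (1 + ν)) ^ 2 := by
        rw [← hμν]
        ring
    _ ≤ 8 * (δ / μ) ^ 2 * growthWeight n u +
          2 * (L ^ 2 * μ ^ (2 * ν)) * ((n : ℝ) ^ (1 + ν) * growthWeight n u) := by
        gcongr
        · exact one_le_growthWeight n u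
        · exact norm_rpow_one_add_sq_le hν₀ hν₁ hn u
    _ = estimatorError ν L μ δ n * growthWeight n u := by
        rw [estimatorError, smoothingError]
        ring

end Estimator

section Descent

variable {E : Type*} [NormedAddCommGroup E] [InnerProductSpace ℝ E]

/-- One step of the method from `x` in the direction `u`. -/
noncomputable def gdStep (ftil : E → ℝ) (μ h : ℝ) (x u : E) : E :=
  x - h • differenceQuotient ftil μ x u • u

/-- An upper bound, in units of the step size, for the change of `f` in one step in the direction
`u`; here `φ` is the gradient at the current point and `D` the estimator error. -/
noncomputable def descentBound (φ : StrongDual ℝ E) (D : ℝ) (n : ℕ) (u : E) : ℝ :=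
  D * growthWeight n u - 3 / 4 * φ u ^ 2 +
    (φ u ^ 2 * ‖u‖ ^ 2 + D * (growthWeight n u * ‖u‖ ^ 2)) / (40 * n)

/-- The level of the expected squared gradient norm, up to a factor, at which the errors of the
estimator and of the quadratic model cancel the guaranteed decrease. -/
noncomputable def stationarityError (ν L μ δ : ℝ) (n : ℕ) : ℝ :=
  5 * estimatorError ν L μ δ n + 400 * smoothingError ν L μ n

variable {f ftil : E → ℝ} {ν L μ δ : ℝ} {n : ℕ}

lemma stationarityError_nonneg (hμ : 0 ≤ μ) : 0 ≤ stationarityError ν L μ δ n :=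
  add_nonneg (mul_nonneg (by norm_num) (estimatorError_nonneg hμ))
    (mul_nonneg (by norm_num) (smoothingError_nonneg hμ))

lemma apply_sub_smul_le_of_holder (hν₀ : 0 ≤ ν) (hν₁ : ν ≤ 1) (hL : 0 < L) (hμ : 0 < μ)
    (hn : 0 < n) (hf : HasHolderGradient f ν L) (x v : E) :
    f (x - stepSize ν L μ n • v) ≤
      f x + stepSize ν L μ n * (‖v‖ ^ 2 / (80 * n) - fderiv ℝ f x v +
        400 * smoothingError ν L μ n) := by
  have : (0 : ℝ) < n := Nat.cast_pos.2 hn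
  have hh : 0 < stepSize ν L μ n := stepSize_pos hL hμ hn
  have htaylor := (le_abs_self _).trans
    (norm_sub_sub_fderiv_le_of_holder hν₀ hf.1 hf.2 x (x - stepSize ν L μ n • v))
  rw [sub_sub_cancel_left, map_neg, map_smul, norm_neg, smul_eq_mul] at htaylor
  have hyoung := mul_rpow_one_add_le_curvature_mul_sq hν₀ hν₁ hL.le hμ hn
    (norm_nonneg (stepSize ν L μ n • v))
  have hquad : curvature ν L μ n * ‖stepSize ν L μ n • v‖ ^ 2 ≤
      stepSize ν L μ n * (‖v‖ ^ 2 / (80 * n)) := by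
    calc curvature ν L μ n * ‖stepSize ν L μ n • v‖ ^ 2
        = stepSize ν L μ n * curvature ν L μ n * (stepSize ν L μ n * ‖v‖ ^ 2) := by
          rw [norm_smul, Real.norm_of_nonneg hh.le]
          ring
      _ ≤ 1 / (80 * n) * (stepSize ν L μ n * ‖v‖ ^ 2) := by
          rw [stepSize_mul_curvature hL hμ hn]
          gcongr
          linarith
      _ = stepSize ν L μ n * (‖v‖ ^ 2 / (80 * n)) := by ring
  linarith [mul_div_sqrt_rpow_le_smoothingError hν₀ hL hμ hn]

lemma apply_gdStep_le (hν₀ : 0 ≤ ν) (hν₁ : ν ≤ 1) (hL : 0 < L) (hμ : 0 < μ) (hn : 0 < n)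
    (hf : HasHolderGradient f ν L) (ho : IsInexactOracle f ftil δ) (x u : E) :
    f (gdStep ftil μ (stepSize ν L μ n) x u) ≤
      f x + stepSize ν L μ n * (descentBound (fderiv ℝ f x) (estimatorError ν L μ δ n) n u +
        400 * smoothingError ν L μ n) := by
  have hh : 0 < stepSize ν L μ n := stepSize_pos hL hμ hn
  have herr := sq_differenceQuotient_sub_fderiv_le hν₀ hν₁ hμ hn hf ho x u
  refine (apply_sub_smul_le_of_holder hν₀ hν₁ hL hμ hn hf x _).trans ?_
  rw [descentBound, norm_smul, Real.norm_eq_abs, mul_pow, sq_abs, map_smul, smul_eq_mul]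
  set p := fderiv ℝ f x u
  set q := differenceQuotient ftil μ x u
  set r := estimatorError ν L μ δ n * growthWeight n u
  have hcross : -(q * p) ≤ r - 3 / 4 * p ^ 2 := by linarith [sq_nonneg (q - p / 2)]
  have hsq : q ^ 2 * ‖u‖ ^ 2 ≤ 2 * (p ^ 2 + r) * ‖u‖ ^ 2 := by
    gcongr
    linarith [sq_nonneg (2 * p - q)]
  have hquad : q ^ 2 * ‖u‖ ^ 2 / (80 * n) ≤
      (p ^ 2 * ‖u‖ ^ 2 + estimatorError ν L μ δ n * (growthWeight n u * ‖u‖ ^ 2)) / (40 * n) := by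
    calc q ^ 2 * ‖u‖ ^ 2 / (80 * n) ≤ 2 * (p ^ 2 + r) * ‖u‖ ^ 2 / (80 * n) := by gcongr
      _ = (p ^ 2 * ‖u‖ ^ 2 + estimatorError ν L μ δ n * (growthWeight n u * ‖u‖ ^ 2)) /
          (40 * n) := by
        field_simp
        ring
  gcongr
  linarith

variable [FiniteDimensional ℝ E] [MeasurableSpace E] [BorelSpace E]

lemma integrable_growthWeight_mul_norm_pow_stdGaussian (n k : ℕ) :
    Integrable (fun u : E => growthWeight n u * ‖u‖ ^ k) (stdGaussian E) := by
  have hexpand : (fun u : E => growthWeight n u * ‖u‖ ^ k) =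
      fun u => ‖u‖ ^ k + ‖u‖ ^ (4 + k) / (n : ℝ) ^ 2 := by
    ext u
    rw [growthWeight]
    ring
  rw [hexpand]
  exact (integrable_norm_pow_stdGaussian k).add ((integrable_norm_pow_stdGaussian _).div_const _)

lemma integrable_growthWeight_stdGaussian (n : ℕ) :
    Integrable (growthWeight n : E → ℝ) (stdGaussian E) := by
  simpa only [pow_zero, mul_one] using
    integrable_growthWeight_mul_norm_pow_stdGaussian (E := E) n 0

lemma integral_growthWeight_mul_norm_pow_stdGaussian (n k : ℕ) :
    ∫ u : E, growthWeight n u * ‖u‖ ^ k ∂(stdGaussian E) =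
      (∫ u : E, ‖u‖ ^ k ∂(stdGaussian E)) +
        (∫ u : E, ‖u‖ ^ (4 + k) ∂(stdGaussian E)) / (n : ℝ) ^ 2 := by
  have hexpand : ∀ u : E, growthWeight n u * ‖u‖ ^ k = ‖u‖ ^ k + ‖u‖ ^ (4 + k) / (n : ℝ) ^ 2 := by
    intro u
    rw [growthWeight]
    ring
  simp_rw [hexpand]
  rw [integral_add (integrable_norm_pow_stdGaussian k)
    ((integrable_norm_pow_stdGaussian _).div_const _), integral_div]

lemma integral_growthWeight_stdGaussian_le (hn : 0 < n) (hE : finrank ℝ E = n) :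
    ∫ u : E, growthWeight n u ∂(stdGaussian E) ≤ 4 := by
  have : (0 : ℝ) < n := Nat.cast_pos.2 hn
  calc ∫ u : E, growthWeight n u ∂(stdGaussian E)
      = 1 + (∫ u : E, ‖u‖ ^ 4 ∂(stdGaussian E)) / (n : ℝ) ^ 2 := by
        simpa using integral_growthWeight_mul_norm_pow_stdGaussian (E := E) n 0
    _ ≤ 1 + 3 * (n : ℝ) ^ 2 / (n : ℝ) ^ 2 := by
        gcongr
        simpa only [hE] using integral_norm_pow_four_stdGaussian_le (E := E)
    _ = 4 := by
        field_simp
        norm_num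

lemma integral_growthWeight_mul_norm_sq_stdGaussian_le (hn : 0 < n) (hE : finrank ℝ E = n) :
    ∫ u : E, growthWeight n u * ‖u‖ ^ 2 ∂(stdGaussian E) ≤ 16 * n := by
  have : (0 : ℝ) < n := Nat.cast_pos.2 hn
  calc ∫ u : E, growthWeight n u * ‖u‖ ^ 2 ∂(stdGaussian E)
      = (∫ u : E, ‖u‖ ^ 2 ∂(stdGaussian E)) +
          (∫ u : E, ‖u‖ ^ 6 ∂(stdGaussian E)) / (n : ℝ) ^ 2 :=
        integral_growthWeight_mul_norm_pow_stdGaussian n 2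
    _ ≤ n + 15 * (n : ℝ) ^ 3 / (n : ℝ) ^ 2 := by
        gcongr
        · simpa only [hE] using integral_norm_sq_stdGaussian_le (E := E)
        · simpa only [hE] using integral_norm_pow_six_stdGaussian_le (E := E)
    _ = 16 * n := by
        field_simp
        norm_num

lemma integrable_descentBound (φ : StrongDual ℝ E) (D : ℝ) (n : ℕ) :
    Integrable (descentBound φ D n) (stdGaussian E) :=
  (((integrable_growthWeight_stdGaussian n).const_mul D).sub
    ((integrable_dual_pow_stdGaussian φ 2).const_mul _)).add
    (((integrable_dual_pow_mul_norm_pow_stdGaussian φ 2 2).add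
      ((integrable_growthWeight_mul_norm_pow_stdGaussian n 2).const_mul D)).div_const _)

lemma integral_descentBound (φ : StrongDual ℝ E) (D : ℝ) (n : ℕ) :
    ∫ u, descentBound φ D n u ∂(stdGaussian E) =
      D * (∫ u : E, growthWeight n u ∂(stdGaussian E)) - 3 / 4 * ‖φ‖ ^ 2 +
        ((∫ u, φ u ^ 2 * ‖u‖ ^ 2 ∂(stdGaussian E)) +
          D * ∫ u : E, growthWeight n u * ‖u‖ ^ 2 ∂(stdGaussian E)) / (40 * n) := by
  have hW := (integrable_growthWeight_stdGaussian (E := E) n).const_mul D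
  have hφ := (integrable_dual_pow_stdGaussian φ 2).const_mul (3 / 4)
  have hφW := integrable_dual_pow_mul_norm_pow_stdGaussian φ 2 2
  have hWW := (integrable_growthWeight_mul_norm_pow_stdGaussian (E := E) n 2).const_mul D
  calc ∫ u, descentBound φ D n u ∂(stdGaussian E)
      = ∫ u, (D * growthWeight n u - 3 / 4 * φ u ^ 2) ∂(stdGaussian E) +
          (∫ u, (φ u ^ 2 * ‖u‖ ^ 2 + D * (growthWeight n u * ‖u‖ ^ 2)) ∂(stdGaussian E)) /
            (40 * n) := by
        rw [← integral_div]
        exact integral_add (hW.sub hφ) ((hφW.add hWW).div_const _)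
    _ = D * (∫ u : E, growthWeight n u ∂(stdGaussian E)) - 3 / 4 * ‖φ‖ ^ 2 +
          ((∫ u, φ u ^ 2 * ‖u‖ ^ 2 ∂(stdGaussian E)) +
            D * ∫ u : E, growthWeight n u * ‖u‖ ^ 2 ∂(stdGaussian E)) / (40 * n) := by
        rw [integral_sub hW hφ, integral_add hφW hWW, integral_const_mul, integral_const_mul,
          integral_const_mul, integral_dual_sq_stdGaussian]

lemma integral_descentBound_le (φ : StrongDual ℝ E) {D : ℝ} (hD : 0 ≤ D) (hn : 0 < n)
    (hE : finrank ℝ E = n) :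
    ∫ u, descentBound φ D n u ∂(stdGaussian E) ≤ 5 * D - ‖φ‖ ^ 2 / 2 := by
  have : (0 : ℝ) < n := Nat.cast_pos.2 hn
  calc ∫ u, descentBound φ D n u ∂(stdGaussian E)
      ≤ D * 4 - 3 / 4 * ‖φ‖ ^ 2 + (3 * n * ‖φ‖ ^ 2 + D * (16 * n)) / (40 * n) := by
        rw [integral_descentBound]
        gcongr
        · exact integral_growthWeight_stdGaussian_le hn hE
        · simpa only [hE] using integral_dual_sq_mul_norm_sq_stdGaussian_le φ
        · exact integral_growthWeight_mul_norm_sq_stdGaussian_le hn hE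
    _ = 22 / 5 * D - 27 / 40 * ‖φ‖ ^ 2 := by
        field_simp
        ring
    _ ≤ 5 * D - ‖φ‖ ^ 2 / 2 := by linarith [sq_nonneg ‖φ‖]

lemma lintegral_ofReal_add_ofReal_le {α : Type*} [MeasurableSpace α] {ρ : Measure α}
    {g B : α → ℝ} {c : ℝ} (hg : 0 ≤ g) (hgB : g ≤ B) (hB : Integrable B ρ) (hc : 0 ≤ c) :
    ∫⁻ a, ENNReal.ofReal (g a) ∂ρ + ENNReal.ofReal c ≤
      ENNReal.ofReal ((∫ a, B a ∂ρ) + c) := by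
  have hB₀ : 0 ≤ B := hg.trans hgB
  rw [ENNReal.ofReal_add (integral_nonneg hB₀) hc,
    ofReal_integral_eq_lintegral_ofReal hB (ae_of_all _ hB₀)]
  gcongr with a
  exact hgB a

/-- Stated with Lebesgue integrals in `ℝ≥0∞`, so that the integrability of `f` along the process
never has to be established. -/
lemma lintegral_apply_gdStep_add_le (hν₀ : 0 ≤ ν) (hν₁ : ν ≤ 1) (hL : 0 < L) (hμ : 0 < μ)
    (hn : 0 < n) (hE : finrank ℝ E = n) (hf : HasHolderGradient f ν L)
    (ho : IsInexactOracle f ftil δ) {m : ℝ} (hm : ∀ x, m ≤ f x) (x : E) :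
    ∫⁻ u, ENNReal.ofReal (f (gdStep ftil μ (stepSize ν L μ n) x u) - m) ∂(stdGaussian E) +
        ENNReal.ofReal (stepSize ν L μ n / 2 * ‖fderiv ℝ f x‖ ^ 2) ≤
      ENNReal.ofReal (f x - m) +
        ENNReal.ofReal (stepSize ν L μ n * stationarityError ν L μ δ n) := by
  have hh : 0 < stepSize ν L μ n := stepSize_pos hL hμ hn
  set h := stepSize ν L μ n
  set b := descentBound (fderiv ℝ f x) (estimatorError ν L μ δ n) n
  set M := 400 * smoothingError ν L μ n with hM
  have hb : Integrable b (stdGaussian E) := integrable_descentBound _ _ _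
  have hbM : Integrable (fun u => h * (b u + M)) (stdGaussian E) :=
    (hb.add (integrable_const M)).const_mul h
  have hmean : ∫ u, (f x - m + h * (b u + M)) ∂(stdGaussian E) + h / 2 * ‖fderiv ℝ f x‖ ^ 2 ≤
      (f x - m) + h * stationarityError ν L μ δ n := by
    calc ∫ u, (f x - m + h * (b u + M)) ∂(stdGaussian E) + h / 2 * ‖fderiv ℝ f x‖ ^ 2
        = f x - m + h * (∫ u, b u ∂(stdGaussian E) + ‖fderiv ℝ f x‖ ^ 2 / 2 + M) := by
          rw [integral_add (integrable_const _) hbM, integral_const_mul,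
            integral_add hb (integrable_const _)]
          simp only [integral_const, probReal_univ, one_smul]
          ring
      _ ≤ f x - m + h * stationarityError ν L μ δ n := by
          gcongr
          rw [stationarityError, ← hM]
          linarith [integral_descentBound_le (fderiv ℝ f x)
            (estimatorError_nonneg (ν := ν) (L := L) (δ := δ) (n := n) hμ.le) hn hE]
  calc ∫⁻ u, ENNReal.ofReal (f (gdStep ftil μ h x u) - m) ∂(stdGaussian E) +
        ENNReal.ofReal (h / 2 * ‖fderiv ℝ f x‖ ^ 2)
      ≤ ENNReal.ofReal (∫ u, (f x - m + h * (b u + M)) ∂(stdGaussian E) +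
          h / 2 * ‖fderiv ℝ f x‖ ^ 2) :=
        lintegral_ofReal_add_ofReal_le (fun u => sub_nonneg.2 (hm _))
          (fun u => by linarith [apply_gdStep_le hν₀ hν₁ hL hμ hn hf ho x u])
          ((integrable_const _).add hbM) (by positivity)
    _ ≤ ENNReal.ofReal ((f x - m) + h * stationarityError ν L μ δ n) :=
        ENNReal.ofReal_le_ofReal hmean
    _ ≤ ENNReal.ofReal (f x - m) + ENNReal.ofReal (h * stationarityError ν L μ δ n) :=
        ENNReal.ofReal_add_le

end Descent

section RandomRecursion

variable {Ω X U : Type*}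

/-- The process `x` is generated from the deterministic state `x₀` by the update rule `F` driven by
the random inputs `u`. -/
structure IsRandomRecursion (F : X → U → X) (x₀ : X) (u : ℕ → Ω → U) (x : ℕ → Ω → X) : Prop where
  zero : ∀ ω, x 0 ω = x₀
  succ : ∀ k ω, x (k + 1) ω = F (x k ω) (u k ω)

namespace IsRandomRecursion

variable [MeasurableSpace X] [MeasurableSpace U] {F : X → U → X} {x₀ : X} {u : ℕ → Ω → U}
  {x : ℕ → Ω → X}

lemma exists_measurable_apply_inputs (hx : IsRandomRecursion F x₀ u x)
    (hF : Measurable (Function.uncurry F)) (k : ℕ) :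
    ∃ Φ : (Finset.range k → U) → X, Measurable Φ ∧ ∀ ω, x k ω = Φ fun j => u j ω := by
  induction k with
  | zero => exact ⟨fun _ => x₀, measurable_const, hx.zero⟩
  | succ k ih =>
    obtain ⟨Φ, hΦ, hxΦ⟩ := ih
    have hsub : Finset.range k ⊆ Finset.range (k + 1) := Finset.range_subset_range.2 k.le_succ
    refine ⟨fun v => F (Φ (Finset.restrict₂ (π := fun _ => U) hsub v))
      (v ⟨k, Finset.self_mem_range_succ k⟩), ?_, fun ω => ?_⟩
    · exact hF.comp ((hΦ.comp (Finset.measurable_restrict₂ hsub)).prodMk (measurable_pi_apply _))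
    · rw [hx.succ, hxΦ]
      rfl

variable [MeasurableSpace Ω] {P : Measure Ω}

lemma aemeasurable (hx : IsRandomRecursion F x₀ u x) (hF : Measurable (Function.uncurry F))
    (hu : ∀ k, AEMeasurable (u k) P) (k : ℕ) : AEMeasurable (x k) P := by
  obtain ⟨Φ, hΦ, hxΦ⟩ := hx.exists_measurable_apply_inputs hF k
  rw [funext hxΦ]
  exact hΦ.comp_aemeasurable (aemeasurable_pi_iff.2 fun j => hu j)

lemma indepFun (hx : IsRandomRecursion F x₀ u x) (hF : Measurable (Function.uncurry F))
    (hu : ∀ k, AEMeasurable (u k) P) (hind : iIndepFun u P) (k : ℕ) :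
    IndepFun (x k) (u k) P := by
  obtain ⟨Φ, hΦ, hxΦ⟩ := hx.exists_measurable_apply_inputs hF k
  rw [funext hxΦ]
  exact (hind.indepFun_finset₀ (Finset.range k) {k} (by simp) hu).comp hΦ
    (measurable_pi_apply (⟨k, Finset.mem_singleton_self k⟩ : ({k} : Finset ℕ)))

variable [IsProbabilityMeasure P] {γ : Measure U}

lemma lintegral_succ (hx : IsRandomRecursion F x₀ u x) (hF : Measurable (Function.uncurry F))
    (hu : ∀ k, HasLaw (u k) γ P) (hind : iIndepFun u P) {V : X → ℝ≥0∞} (hV : Measurable V)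
    (k : ℕ) :
    ∫⁻ ω, V (x (k + 1) ω) ∂P = ∫⁻ ω, ∫⁻ v, V (F (x k ω) v) ∂γ ∂P := by
  have hum : ∀ k, AEMeasurable (u k) P := fun k => (hu k).aemeasurable
  have hxm : AEMeasurable (x k) P := hx.aemeasurable hF hum k
  have : IsProbabilityMeasure γ := (hu k).isProbabilityMeasure_iff.1 inferInstance
  have hlaw : P.map (fun ω => (x k ω, u k ω)) = (P.map (x k)).prod γ := by
    rw [(indepFun_iff_map_prod_eq_prod_map_map hxm (hum k)).1 (hx.indepFun hF hum hind k),
      (hu k).map_eq]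
  have hVF : Measurable fun p : X × U => V (F p.1 p.2) := hV.comp hF
  calc ∫⁻ ω, V (x (k + 1) ω) ∂P
      = ∫⁻ p, V (F p.1 p.2) ∂(P.map fun ω => (x k ω, u k ω)) := by
        simp_rw [lintegral_map' hVF.aemeasurable (hxm.prodMk (hum k)), hx.succ]
    _ = ∫⁻ y, ∫⁻ v, V (F y v) ∂γ ∂(P.map (x k)) := by
        rw [hlaw, lintegral_prod _ hVF.aemeasurable]
    _ = ∫⁻ ω, ∫⁻ v, V (F (x k ω) v) ∂γ ∂P :=
        lintegral_map' hVF.lintegral_prod_right'.aemeasurable hxm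

lemma lintegral_add_sum_lintegral_le (hx : IsRandomRecursion F x₀ u x)
    (hF : Measurable (Function.uncurry F)) (hu : ∀ k, HasLaw (u k) γ P) (hind : iIndepFun u P)
    {V G : X → ℝ≥0∞} {R : ℝ≥0∞} (hV : Measurable V) (hG : Measurable G)
    (hdrift : ∀ y, ∫⁻ v, V (F y v) ∂γ + G y ≤ V y + R) (N : ℕ) :
    ∫⁻ ω, V (x N ω) ∂P + ∑ k ∈ Finset.range N, ∫⁻ ω, G (x k ω) ∂P ≤ V x₀ + N * R := by
  have hGx : ∀ k, AEMeasurable (fun ω => G (x k ω)) P := fun k =>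
    hG.comp_aemeasurable (hx.aemeasurable hF (fun k => (hu k).aemeasurable) k)
  have hstep : ∀ k, ∫⁻ ω, V (x (k + 1) ω) ∂P + ∫⁻ ω, G (x k ω) ∂P ≤
      ∫⁻ ω, V (x k ω) ∂P + R := by
    intro k
    calc ∫⁻ ω, V (x (k + 1) ω) ∂P + ∫⁻ ω, G (x k ω) ∂P
        = ∫⁻ ω, (∫⁻ v, V (F (x k ω) v) ∂γ + G (x k ω)) ∂P := by
          rw [hx.lintegral_succ hF hu hind hV, lintegral_add_right' _ (hGx k)]
      _ ≤ ∫⁻ ω, (V (x k ω) + R) ∂P := lintegral_mono fun ω => hdrift _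
      _ = ∫⁻ ω, V (x k ω) ∂P + R := by
          rw [lintegral_add_right _ measurable_const, lintegral_const, measure_univ, mul_one]
  induction N with
  | zero => simp [hx.zero]
  | succ N ih =>
    calc ∫⁻ ω, V (x (N + 1) ω) ∂P + ∑ k ∈ Finset.range (N + 1), ∫⁻ ω, G (x k ω) ∂P
        = (∫⁻ ω, V (x (N + 1) ω) ∂P + ∫⁻ ω, G (x N ω) ∂P) +
            ∑ k ∈ Finset.range N, ∫⁻ ω, G (x k ω) ∂P := by
          rw [Finset.sum_range_succ]
          ring
      _ ≤ (∫⁻ ω, V (x N ω) ∂P + R) + ∑ k ∈ Finset.range N, ∫⁻ ω, G (x k ω) ∂P :=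
          add_le_add_left (hstep N) _
      _ = (∫⁻ ω, V (x N ω) ∂P + ∑ k ∈ Finset.range N, ∫⁻ ω, G (x k ω) ∂P) + R := by ring
      _ ≤ V x₀ + N * R + R := by gcongr
      _ = V x₀ + (N + 1 : ℕ) * R := by
          push_cast
          ring

end IsRandomRecursion

lemma integrable_and_sum_integral_le_of_sum_lintegral_le {Ω ι : Type*} [MeasurableSpace Ω]
    {P : Measure Ω} {s : Finset ι} {g : ι → Ω → ℝ} {b : ℝ}
    (hg : ∀ i ∈ s, AEStronglyMeasurable (g i) P) (hg₀ : ∀ i ω, 0 ≤ g i ω) (hb : 0 ≤ b)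
    (hsum : ∑ i ∈ s, ∫⁻ ω, ENNReal.ofReal (g i ω) ∂P ≤ ENNReal.ofReal b) :
    (∀ i ∈ s, Integrable (g i) P) ∧ ∑ i ∈ s, ∫ ω, g i ω ∂P ≤ b := by
  have hint : ∀ i ∈ s, Integrable (g i) P := fun i hi => by
    refine ⟨hg i hi, (hasFiniteIntegral_iff_ofReal (ae_of_all _ (hg₀ i))).2 ?_⟩
    exact ((Finset.single_le_sum (f := fun i => ∫⁻ ω, ENNReal.ofReal (g i ω) ∂P)
      (fun _ _ => zero_le) hi).trans hsum).trans_lt ENNReal.ofReal_lt_top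
  refine ⟨hint, (ENNReal.ofReal_le_ofReal_iff hb).1 ?_⟩
  calc ENNReal.ofReal (∑ i ∈ s, ∫ ω, g i ω ∂P)
      = ∑ i ∈ s, ∫⁻ ω, ENNReal.ofReal (g i ω) ∂P := by
        rw [ENNReal.ofReal_sum_of_nonneg fun i _ => integral_nonneg (hg₀ i)]
        exact Finset.sum_congr rfl fun i hi =>
          ofReal_integral_eq_lintegral_ofReal (hint i hi) (ae_of_all _ (hg₀ i))
    _ ≤ ENNReal.ofReal b := hsum

end RandomRecursion

section Convergence

variable {E : Type*} [NormedAddCommGroup E] [InnerProductSpace ℝ E]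
  {f ftil : E → ℝ} {ν L μ h δ : ℝ} {n : ℕ} {x₀ : E}

lemma measurable_gdStep [MeasurableSpace E] [BorelSpace E] [SecondCountableTopology E]
    (hft : Measurable ftil) : Measurable (Function.uncurry (gdStep ftil μ h)) := by
  unfold Function.uncurry gdStep differenceQuotient
  fun_prop

variable [FiniteDimensional ℝ E] {Ω : Type*} {u : ℕ → Ω → E}

lemma isRandomRecursion_gdProcess (ftil : E → ℝ) (μ h : ℝ) (x₀ : E) (u : ℕ → Ω → E) :
    IsRandomRecursion (gdStep ftil μ h) x₀ u
      fun k ω => gdProcess ftil μ h x₀ (fun j => u j ω) k where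
  zero _ := rfl
  succ k ω := by simp [gdProcess, gdStep, gradEstimator, differenceQuotient]

variable [MeasurableSpace E] [BorelSpace E] [MeasurableSpace Ω] {P : Measure Ω}
  [IsProbabilityMeasure P]

lemma integrable_and_sum_integral_norm_fderiv_sq_le (hν₀ : 0 ≤ ν) (hν₁ : ν ≤ 1) (hL : 0 < L)
    (hμ : 0 < μ) (hn : 0 < n) (hE : finrank ℝ E = n) (hf : HasHolderGradient f ν L)
    (hft : Measurable ftil) (ho : IsInexactOracle f ftil δ) {m : ℝ} (hm : ∀ x, m ≤ f x)
    (hind : iIndepFun u P) (hu : ∀ k, HasLaw (u k) (stdGaussian E) P) (N : ℕ) :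
    let G := fun k ω => ‖fderiv ℝ f
      (gdProcess ftil μ (stepSize ν L μ n) x₀ (fun j => u j ω) k)‖ ^ 2
    (∀ k < N, Integrable (G k) P) ∧
      stepSize ν L μ n / 2 * ∑ k ∈ Finset.range N, ∫ ω, G k ω ∂P ≤
        f x₀ - m + N * (stepSize ν L μ n * stationarityError ν L μ δ n) := by
  intro G
  have hh : 0 < stepSize ν L μ n := stepSize_pos hL hμ hn
  set h := stepSize ν L μ n
  have hgap : 0 ≤ f x₀ - m := sub_nonneg.2 (hm x₀)
  have herr : 0 ≤ h * stationarityError ν L μ δ n :=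
    mul_nonneg hh.le (stationarityError_nonneg hμ.le)
  have hx := isRandomRecursion_gdProcess ftil μ h x₀ u
  have hgrad : Measurable fun y => h / 2 * ‖fderiv ℝ f y‖ ^ 2 :=
    ((measurable_fderiv ℝ f).norm.pow_const 2).const_mul _
  have hsum : ∑ k ∈ Finset.range N, ∫⁻ ω, ENNReal.ofReal (h / 2 * G k ω) ∂P ≤
      ENNReal.ofReal (f x₀ - m + N * (h * stationarityError ν L μ δ n)) := by
    rw [ENNReal.ofReal_add hgap (by positivity), ENNReal.ofReal_mul N.cast_nonneg,
      ENNReal.ofReal_natCast]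
    exact le_add_self.trans <| hx.lintegral_add_sum_lintegral_le (measurable_gdStep hft) hu hind
      (hf.1.continuous.measurable.sub_const m).ennreal_ofReal hgrad.ennreal_ofReal
      (lintegral_apply_gdStep_add_le hν₀ hν₁ hL hμ hn hE hf ho hm) N
  obtain ⟨hint, hle⟩ := integrable_and_sum_integral_le_of_sum_lintegral_le
    (g := fun k ω => h / 2 * G k ω) (fun k _ => (hgrad.comp_aemeasurable
      (hx.aemeasurable (measurable_gdStep hft) (fun k => (hu k).aemeasurable)
        k)).aestronglyMeasurable)
    (fun k ω => by positivity) (by positivity) hsum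
  simp_rw [integral_const_mul, ← Finset.mul_sum] at hle
  exact ⟨fun k hk => (integrable_const_mul_iff (half_pos hh).ne'.isUnit _).1
    (hint k (Finset.mem_range.2 hk)), hle⟩

lemma integrable_and_exists_integral_norm_fderiv_sq_le (hν₀ : 0 ≤ ν) (hν₁ : ν ≤ 1) (hL : 0 < L)
    (hμ : 0 < μ) (hn : 0 < n) (hE : finrank ℝ E = n) (hf : HasHolderGradient f ν L)
    (hft : Measurable ftil) (ho : IsInexactOracle f ftil δ) {m : ℝ} (hm : ∀ x, m ≤ f x)
    (hind : iIndepFun u P) (hu : ∀ k, HasLaw (u k) (stdGaussian E) P) {ε : ℝ} {N : ℕ}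
    (hε : 4 * stationarityError ν L μ δ n ≤ ε) (hN₀ : 0 < N)
    (hN : 4 * (f x₀ - m) ≤ N * (stepSize ν L μ n * ε)) :
    let G := fun k ω => ‖fderiv ℝ f
      (gdProcess ftil μ (stepSize ν L μ n) x₀ (fun j => u j ω) k)‖ ^ 2
    (∀ k < N, Integrable (G k) P) ∧ ∃ k < N, ∫ ω, G k ω ∂P ≤ ε := by
  intro G
  have hh : 0 < stepSize ν L μ n := stepSize_pos hL hμ hn
  obtain ⟨hint, hsum⟩ := integrable_and_sum_integral_norm_fderiv_sq_le (x₀ := x₀) hν₀ hν₁ hL hμ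
    hn hE hf hft ho hm hind hu N
  have havg : ∑ k ∈ Finset.range N, ∫ ω, G k ω ∂P ≤ ∑ _k ∈ Finset.range N, ε := by
    rw [Finset.sum_const, Finset.card_range, nsmul_eq_mul]
    refine le_of_mul_le_mul_left (hsum.trans ?_) (half_pos hh)
    have herr : N * (stepSize ν L μ n * (4 * stationarityError ν L μ δ n)) ≤
        N * (stepSize ν L μ n * ε) := by gcongr
    linarith
  obtain ⟨k, hk, hle⟩ := Finset.exists_le_of_sum_le (Finset.nonempty_range_iff.2 hN₀.ne') havg
  exact ⟨hint, k, Finset.mem_range.1 hk, hle⟩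

end Convergence

section Parameters

variable {κ ν L μ δ ε εmax : ℝ} {n : ℕ}

/-- The smoothing parameter `(κ ε / n ^ (1 + ν)) ^ (1 / (2 ν))`, for which `smoothingError` equals
`κ L² ε`. -/
noncomputable def smoothing (κ ν : ℝ) (n : ℕ) (ε : ℝ) : ℝ :=
  (κ * ε / (n : ℝ) ^ (1 + ν)) ^ (1 / (2 * ν))

lemma smoothing_pos (hκ : 0 < κ) (hε : 0 < ε) (hn : 0 < n) : 0 < smoothing κ ν n ε := by
  unfold smoothing
  positivity

lemma smoothing_rpow (hκ : 0 ≤ κ) (hε : 0 ≤ ε) (p : ℝ) :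
    smoothing κ ν n ε ^ p = (κ * ε) ^ (p / (2 * ν)) / (n : ℝ) ^ ((1 + ν) * (p / (2 * ν))) := by
  unfold smoothing
  rw [← Real.rpow_mul (by positivity), one_div_mul_eq_div,
    Real.div_rpow (by positivity) (by positivity), ← Real.rpow_mul (by positivity)]

lemma smoothing_rpow_two_mul (hν : 0 < ν) (hκ : 0 ≤ κ) (hε : 0 ≤ ε) :
    smoothing κ ν n ε ^ (2 * ν) = κ * ε / (n : ℝ) ^ (1 + ν) := by
  rw [smoothing_rpow hκ hε, div_self (by positivity), Real.rpow_one, mul_one]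

lemma smoothing_lt_one (hν : 0 < ν) (hκ : 0 ≤ κ) (hε : 0 ≤ ε) (hn : 0 < n) (hκε : κ * ε < 1) :
    smoothing κ ν n ε < 1 :=
  Real.rpow_lt_one (by positivity) ((div_le_self (by positivity)
    (Real.one_le_rpow (Nat.one_le_cast.2 hn) (by linarith))).trans_lt hκε) (by positivity)

lemma smoothingError_smoothing (hν : 0 < ν) (hκ : 0 ≤ κ) (hε : 0 ≤ ε) (hn : 0 < n) :
    smoothingError ν L (smoothing κ ν n ε) n = L ^ 2 * (κ * ε) := by
  have : (0 : ℝ) < n := Nat.cast_pos.2 hn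
  rw [smoothingError, smoothing_rpow_two_mul hν hκ hε]
  field_simp

lemma noiseLevel_smoothing (hν : 0 < ν) (hκ : 0 ≤ κ) (hε : 0 ≤ ε) (hn : 0 < n) :
    noiseLevel ν (smoothing κ ν n ε) n = κ ^ ((3 + ν) / (4 * ν)) * noiseOrder ν ε n := by
  have hε_exp : (3 + ν) / 2 / (2 * ν) = (3 + ν) / (4 * ν) := by
    field_simp
    norm_num
  have hn_exp : (1 + ν) * ((3 + ν) / (4 * ν)) + (3 - ν) / 4 = (3 + 7 * ν) / (4 * ν) := by
    field_simp
    ring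
  rw [noiseLevel, noiseOrder, smoothing_rpow hκ hε, div_div, hε_exp,
    ← Real.rpow_add (Nat.cast_pos.2 hn), hn_exp, Real.mul_rpow hκ hε, mul_div_assoc]

lemma sq_div_le_of_le_noiseLevel (hν : ν ≤ 1) (hμ₀ : 0 < μ) (hμ₁ : μ ≤ 1) (hn : 0 < n)
    (hδ₀ : 0 ≤ δ) (hδ : δ ≤ noiseLevel ν μ n) : (δ / μ) ^ 2 ≤ μ ^ (2 * ν) := by
  have hδμ : δ ≤ μ ^ ((3 + ν) / 2) := hδ.trans <| div_le_self (by positivity)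
    (Real.one_le_rpow (Nat.one_le_cast.2 hn) (by linarith))
  calc (δ / μ) ^ 2 ≤ (μ ^ ((3 + ν) / 2) / μ) ^ 2 := by gcongr
    _ = μ ^ (1 + ν) := by
        rw [← Real.rpow_sub_one hμ₀.ne', ← Real.rpow_mul_natCast hμ₀.le]
        push_cast
        ring_nf
    _ ≤ μ ^ (2 * ν) := Real.rpow_le_rpow_of_exponent_ge hμ₀ hμ₁ (by linarith)

lemma stationarityError_smoothing_le (hν₀ : 0 < ν) (hν₁ : ν ≤ 1) (hκ : 0 < κ) (hε : 0 < ε)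
    (hn : 0 < n) (hκε : κ * ε < 1) (hδ₀ : 0 ≤ δ)
    (hδ : δ ≤ noiseLevel ν (smoothing κ ν n ε) n) :
    stationarityError ν L (smoothing κ ν n ε) δ n ≤ (410 * L ^ 2 + 40) * κ * ε := by
  have hnoise : (δ / smoothing κ ν n ε) ^ 2 ≤ κ * ε := by
    calc (δ / smoothing κ ν n ε) ^ 2 ≤ smoothing κ ν n ε ^ (2 * ν) :=
          sq_div_le_of_le_noiseLevel hν₁ (smoothing_pos hκ hε hn)
            (smoothing_lt_one hν₀ hκ.le hε.le hn hκε).le hn hδ₀ hδ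
      _ = κ * ε / (n : ℝ) ^ (1 + ν) := smoothing_rpow_two_mul hν₀ hκ.le hε.le
      _ ≤ κ * ε := div_le_self (by positivity)
          (Real.one_le_rpow (Nat.one_le_cast.2 hn) (by linarith))
  rw [stationarityError, estimatorError, smoothingError_smoothing hν₀ hκ.le hε.le hn]
  linarith

lemma exists_smoothing_constant (L : ℝ) (hεmax : 0 ≤ εmax) :
    ∃ κ > 0, κ * εmax < 1 ∧ 4 * ((410 * L ^ 2 + 40) * κ) ≤ 1 := by
  refine ⟨1 / (4 * (410 * L ^ 2 + 40) + εmax), by positivity, ?_, ?_⟩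
  · rw [one_div_mul_eq_div, div_lt_one (by positivity)]
    linarith [sq_nonneg L]
  · rw [mul_one_div, mul_div_assoc', div_le_one (by positivity)]
    linarith

lemma stepsOrder_nonneg (hε : 0 ≤ ε) : 0 ≤ stepsOrder ν ε n := by
  unfold stepsOrder
  positivity

lemma one_div_stepSize_mul_le (hν₀ : 0 < ν) (hν₁ : ν ≤ 1) (hL : 0 < L) (hκ : 0 < κ) (hε : 0 < ε)
    (hεmax : ε ≤ εmax) (hn : 0 < n) :
    1 / (stepSize ν L (smoothing κ ν n ε) n * ε) ≤
      400 * L * (εmax / κ) ^ ((1 - ν) / (2 * ν)) * stepsOrder ν ε n := by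
  have hn₀ : (0 : ℝ) < n := Nat.cast_pos.2 hn
  set p := (1 - ν) / (2 * ν) with hp
  have : 0 ≤ p := div_nonneg (by linarith) (by linarith)
  have hνp : 2 * ν * p = 1 - ν := by
    rw [hp]
    field_simp
  have hn_pow : (n : ℝ) ^ (2 + p) = n * ((n : ℝ) ^ ((1 + ν) / 2) * (n : ℝ) ^ ((1 + ν) * p)) := by
    rw [← Real.rpow_add hn₀, ← Real.rpow_one_add' hn₀.le (by positivity)]
    congr 1
    linarith
  have hε_pow : ε ^ (1 / ν) = ε ^ p * ε ^ p * ε := by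
    rw [← Real.rpow_add hε, ← Real.rpow_add_one hε.ne']
    congr 1
    rw [hp]
    field_simp
    ring
  have hdim : ((n : ℝ) + 4) / n ≤ 5 := by
    rw [div_le_iff₀ hn₀]
    linarith [Nat.one_le_cast (α := ℝ).2 hn]
  have hS : 0 ≤ stepsOrder ν ε n := stepsOrder_nonneg hε.le
  calc 1 / (stepSize ν L (smoothing κ ν n ε) n * ε)
      = 80 * ((n + 4) / n) * L * (ε / κ) ^ p * stepsOrder ν ε n := by
        rw [stepSize, stepsOrder, smoothing_rpow hκ.le hε.le, ← hp, hn_pow, hε_pow,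
          Real.mul_rpow hκ.le hε.le, Real.div_rpow hε.le hκ.le]
        field_simp
    _ ≤ 80 * 5 * L * (εmax / κ) ^ p * stepsOrder ν ε n := by gcongr
    _ = 400 * L * (εmax / κ) ^ p * stepsOrder ν ε n := by ring

lemma one_le_rpow_mul_stepsOrder (hν₀ : 0 < ν) (hν₁ : ν ≤ 1) (hε : 0 < ε) (hεmax : ε ≤ εmax)
    (hn : 0 < n) : 1 ≤ εmax ^ (1 / ν) * stepsOrder ν ε n := by
  have hε_pow : ε ^ (1 / ν) ≤ εmax ^ (1 / ν) := by gcongr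
  have hn_pow : (1 : ℝ) ≤ (n : ℝ) ^ (2 + (1 - ν) / (2 * ν)) :=
    Real.one_le_rpow (Nat.one_le_cast.2 hn)
      (add_nonneg zero_le_two (div_nonneg (by linarith) (by linarith)))
  rw [stepsOrder, ← mul_div_assoc, one_le_div (by positivity)]
  exact hε_pow.trans (le_mul_of_one_le_right (Real.rpow_nonneg (hε.le.trans hεmax) _) hn_pow)

lemma exists_steps (hν₀ : 0 < ν) (hν₁ : ν ≤ 1) (hL : 0 < L) (hκ : 0 < κ) (hεmax : 0 < εmax)
    (Δ : ℝ) :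
    ∃ C > 0, ∀ (n : ℕ) (ε : ℝ), 0 < n → 0 < ε → ε ≤ εmax →
      ∃ N : ℕ, 0 < N ∧ N ≤ C * stepsOrder ν ε n ∧
        4 * Δ ≤ N * (stepSize ν L (smoothing κ ν n ε) n * ε) := by
  set K := 400 * L * (εmax / κ) ^ ((1 - ν) / (2 * ν))
  refine ⟨4 * max Δ 0 * K + εmax ^ (1 / ν), by positivity, fun n ε hn hε hεm => ?_⟩
  have hh : 0 < stepSize ν L (smoothing κ ν n ε) n := stepSize_pos hL (smoothing_pos hκ hε hn) hn
  set η := stepSize ν L (smoothing κ ν n ε) n * ε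
  have hη : 0 < η := mul_pos hh hε
  refine ⟨⌊4 * max Δ 0 / η⌋₊ + 1, Nat.succ_pos _, ?_, ?_⟩
  · calc ((⌊4 * max Δ 0 / η⌋₊ + 1 : ℕ) : ℝ) ≤ 4 * max Δ 0 * (1 / η) + 1 := by
          rw [Nat.cast_add_one, mul_one_div]
          gcongr
          exact Nat.floor_le (by positivity)
      _ ≤ 4 * max Δ 0 * (K * stepsOrder ν ε n) + εmax ^ (1 / ν) * stepsOrder ν ε n := by
          gcongr
          · exact one_div_stepSize_mul_le hν₀ hν₁ hL hκ hε hεm hn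
          · exact one_le_rpow_mul_stepsOrder hν₀ hν₁ hε hεm hn
      _ = (4 * max Δ 0 * K + εmax ^ (1 / ν)) * stepsOrder ν ε n := by ring
  · calc 4 * Δ ≤ 4 * max Δ 0 := by
          gcongr
          exact le_max_left Δ 0
      _ ≤ (⌊4 * max Δ 0 / η⌋₊ + 1 : ℕ) * η := by
          rw [← div_le_iff₀ hη, Nat.cast_add_one]
          exact (Nat.lt_floor_add_one _).le

end Parameters

end ZerothOrder

/-- Choice of constants: `ν`, `L` and an upper bound `εmax` on the accuracies are fixed. The
smoothing parameter `μ n ε` depends on these and on `n` and `ε` only; the constant `C` in the number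
of steps depends moreover on a bound `Δ` for `f x₀ - inf f`. Nothing depends on the space, the
function, the oracle, the starting point or the probability space. -/
theorem theorem1 (ν L εmax : ℝ) (hν₀ : 0 < ν) (hν₁ : ν ≤ 1) (hL : 0 < L) (hεmax : 0 < εmax) :
    ∃ (c₁ c₂ : ℝ) (μ : ℕ → ℝ → ℝ), 0 < c₁ ∧ 0 < c₂ ∧
      (∀ (n : ℕ) (ε : ℝ), 1 ≤ n → 0 < ε → ε ≤ εmax →
        0 < μ n ε ∧ μ n ε < 1 ∧
        c₁ * ZerothOrder.noiseOrder ν ε n ≤ ZerothOrder.noiseLevel ν (μ n ε) n ∧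
        ZerothOrder.noiseLevel ν (μ n ε) n ≤ c₂ * ZerothOrder.noiseOrder ν ε n) ∧
      ∀ Δ : ℝ, ∃ C : ℝ, 0 < C ∧ ∀ (n : ℕ) (ε : ℝ), 1 ≤ n → 0 < ε → ε ≤ εmax →
        ∃ N : ℕ, (N : ℝ) ≤ C * ZerothOrder.stepsOrder ν ε n ∧
          ∀ (E : Type*) [NormedAddCommGroup E] [InnerProductSpace ℝ E] [FiniteDimensional ℝ E]
            [MeasurableSpace E] [BorelSpace E] (f ftil : E → ℝ) (δ : ℝ) (x₀ : E)
            (Ω : Type*) [MeasurableSpace Ω] (P : Measure Ω) [IsProbabilityMeasure P]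
            (u : ℕ → Ω → E),
            Module.finrank ℝ E = n →
            ZerothOrder.HasHolderGradient f ν L →
            BddBelow (Set.range f) →
            f x₀ - (⨅ x, f x) ≤ Δ →
            Measurable ftil →
            ZerothOrder.IsInexactOracle f ftil δ →
            δ < ZerothOrder.noiseLevel ν (μ n ε) n →
            iIndepFun u P →
            (∀ k, HasLaw (u k) (stdGaussian E) P) →
            (∀ k < N, Integrable (fun ω => ‖fderiv ℝ f (ZerothOrder.gdProcess ftil (μ n ε)
              (ZerothOrder.stepSize ν L (μ n ε) n) x₀ (fun j => u j ω) k)‖ ^ 2) P) ∧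
            ∃ k < N, ∫ ω, ‖fderiv ℝ f (ZerothOrder.gdProcess ftil (μ n ε)
              (ZerothOrder.stepSize ν L (μ n ε) n) x₀ (fun j => u j ω) k)‖ ^ 2 ∂P ≤ ε := by
  obtain ⟨κ, hκ, hκεmax, hκL⟩ := ZerothOrder.exists_smoothing_constant L hεmax.le
  have hκε : ∀ ε ≤ εmax, κ * ε < 1 := fun ε hε =>
    (mul_le_mul_of_nonneg_left hε hκ.le).trans_lt hκεmax
  refine ⟨κ ^ ((3 + ν) / (4 * ν)), κ ^ ((3 + ν) / (4 * ν)), ZerothOrder.smoothing κ ν,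
    by positivity, by positivity, fun n ε hn hε hεm => ?_, fun Δ => ?_⟩
  · have hlevel := ZerothOrder.noiseLevel_smoothing hν₀ hκ.le hε.le hn
    exact ⟨ZerothOrder.smoothing_pos hκ hε hn,
      ZerothOrder.smoothing_lt_one hν₀ hκ.le hε.le hn (hκε ε hεm), hlevel.ge, hlevel.le⟩
  obtain ⟨C, hC, hsteps⟩ := ZerothOrder.exists_steps hν₀ hν₁ hL hκ hεmax Δ
  refine ⟨C, hC, fun n ε hn hε hεm => ?_⟩
  obtain ⟨N, hN₀, hNC, hNΔ⟩ := hsteps n ε hn hε hεm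
  refine ⟨N, hNC, fun E _ _ _ _ _ f ftil δ x₀ Ω _ P _ u hE hf hbdd hΔ hft ho hδ hind hu => ?_⟩
  have herr : 4 * ZerothOrder.stationarityError ν L (ZerothOrder.smoothing κ ν n ε) δ n ≤ ε := by
    have hδ₀ : 0 ≤ δ := (abs_nonneg _).trans (ho x₀)
    linarith [mul_le_mul_of_nonneg_right hκL hε.le,
      ZerothOrder.stationarityError_smoothing_le (L := L) hν₀ hν₁ hκ hε hn (hκε ε hεm) hδ₀ hδ.le]
  exact ZerothOrder.integrable_and_exists_integral_norm_fderiv_sq_le hν₀.le hν₁ hL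
    (ZerothOrder.smoothing_pos hκ hε hn) hn hE hf hft ho (ciInf_le hbdd) hind hu herr hN₀
    (by linarith)
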